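/- **Setting.** Let $\Omega\in\mathbb R^{p\times n}$ have full rank, let $\sigma_{\max}(\Omega)$ and $\sigma_{\min}(\Omega)>0$ be the largest and the smallest of its $\min(p,n)$ singular values, and let $\kappa(\Omega)=\sigma_{\max}(\Omega)/\sigma_{\min}(\Omega)$. Let $x\in\mathbb R^n$, let $\mathcal S=\{j:(\Omega x)_j\ne0\}$, and let $\{\mathcal P_i\}_{i=1}^L$ be a partition of $\{1,\dots,p\}$ with $\mathcal P_i\cap\mathcal S\neq\emptyset$ for every $i$. Put $\rho_i=|\mathcal P_i|/p$, $\alpha_i=|\mathcal P_i\cap\mathcal S|/|\mathcal P_i|$, and $s_i=|\mathcal P_i\cap\mathcal S|=\|(\Omega x)_{\mathcal P_i}\|_0$, where $(\Omega x)_{\mathcal P_i}\in\mathbb R^{\mathcal P_i}$ is the subvector of $\Omega x$ with entries indexed by $\mathcal P_i$. For $w\ge 0$ let $\|z\|_{1,w}=\sum_j w_j|z_j|$. For a convex $f$ let $\mathcal D(f,y)=\{z:\ f(y+tz)\le f(y)\text{ for some }t>0\}$ be its descent cone at $y$. For a convex cone $C$ let $\delta(C)=\mathbb E\,\mathrm{dist}^2(g,C^\circ)$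 be its statistical dimension, where $g$ is a standard Gaussian vector and $C^\circ$ is the polar cone of $C$. For $\omega\in\mathbb R_+^L$ put $D\omega=\sum_i\omega_i\mathbf 1_{\mathcal P_i}\in\mathbb R_+^p$. The normalized number of Gaussian measurements needed by the weighted $\ell_1$-analysis program $\mathsf P_{1,\Omega,D\omega}$ to recover $x$ is defined as $$m_{D\omega}=\kappa^2(\Omega)\,\frac{\delta(\mathcal D(\|\cdot\|_{1,D\omega},\Omega x))}{p}+\frac1p ,$$ and the normalized number needed by the unweighted $\ell_1$ program for the piece $(\Omega x)_{\mathcal P_i}$ alone is defined as $$m_i=\kappa^2(\Omega)\,\frac{\delta(\mathcal D(\|\cdot\|_{1},(\Omega x)_{\mathcal P_i}))}{p}+\frac1p .$$ Let $\phi(z)=\sqrt{2/\pi}\int_z^\infty(u-z)^2e^{-u^2/2}\,du$. Optimal weights are the minimizers $\omega^*$ over $\mathbb R_+^L$ of $$\hat m_{D\omega}=\kappa^2(\Omega)\inf_{t\ge0}\sum_{i=1}^L\rho_i\Big(\alpha_i(t^2\omega_i^2+1)+(1-\alpha_i)\phi(t\omega_i)\Big)+\frac1p .$$ **Theorem.**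 Optimal weights exist, and for all optimal weights $\omega^*$ the number of measurements needed with $\omega^*$ equals the sum of the numbers needed for the pieces separately, up to the following explicit error: $$\frac{1-L}{p}-\frac{2\kappa^2(\Omega)}{\sqrt{pL}}\ \le\ m_{D\omega^*}-\sum_{i=1}^L m_i\ \le\ \frac{2\kappa^2(\Omega)}{\sqrt p}\sum_{i=1}^L\frac1{\sqrt{s_i}}+\frac{1-L}{p}.$$ -/

import Mathlib

open MeasureTheory ProbabilityTheory

/-- The weighted `ℓ₁` functional `‖z‖_{1,w} = ∑ i, w i * |z i|` on `ℝ^ι`. -/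
noncomputable def weightedL1 {ι : Type*} [Fintype ι] (w : ι → ℝ) (z : EuclideanSpace ℝ ι) : ℝ :=
  ∑ i, w i * |z i|

/-- The descent cone of `f` at `x`: all directions along which some positive step does not
increase `f`. -/
def descentCone {E : Type*} [AddCommGroup E] [Module ℝ E] (f : E → ℝ) (x : E) : Set E :=
  {z | ∃ t : ℝ, 0 < t ∧ f (x + t • z) ≤ f x}

/-- The polar cone `C° = {y : ⟪y, z⟫ ≤ 0 for all z ∈ C}`. -/
def polarCone {E : Type*} [NormedAddCommGroup E] [InnerProductSpace ℝ E] (C : Set E) : Set E :=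
  {y | ∀ z ∈ C, inner ℝ y z ≤ 0}

/-- The statistical dimension `δ(C) = 𝔼 dist²(g, C°)` of a convex cone `C ⊆ ℝ^ι`, where `g` is a
standard Gaussian vector. -/
noncomputable def statDim {ι : Type*} [Fintype ι] (C : Set (EuclideanSpace ℝ ι)) : ℝ :=
  ∫ g, Metric.infDist g (polarCone C) ^ 2 ∂(stdGaussian (EuclideanSpace ℝ ι))

/-- The largest singular value of `Ω`. -/
noncomputable def sigmaMax {p n : ℕ} (Ω : Matrix (Fin p) (Fin n) ℝ) : ℝ :=
  (Matrix.toEuclideanLin Ω).singularValues 0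

/-- The smallest of the `min p n` singular values of the `p × n` matrix `Ω` (the singular values
of a linear map are listed in decreasing order, starting from index `0`). It is positive if and
only if `Ω` has full rank. -/
noncomputable def sigmaMin {p n : ℕ} (Ω : Matrix (Fin p) (Fin n) ℝ) : ℝ :=
  (Matrix.toEuclideanLin Ω).singularValues (min p n - 1)

/-- The condition number `κ(Ω) = σ_max(Ω) / σ_min(Ω)`. -/
noncomputable def condNumber {p n : ℕ} (Ω : Matrix (Fin p) (Fin n) ℝ) : ℝ :=
  sigmaMax Ω / sigmaMin Ω

/-- The support of a vector in `ℝ^p`. -/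
noncomputable def vecSupport {p : ℕ} (y : EuclideanSpace ℝ (Fin p)) : Finset (Fin p) :=
  {j | y j ≠ 0}

/-- The subvector `y_T ∈ ℝ^T` of `y ∈ ℝ^p` consisting of the entries indexed by `T`. -/
noncomputable def subvector {p : ℕ} (y : EuclideanSpace ℝ (Fin p)) (T : Finset (Fin p)) :
    EuclideanSpace ℝ T :=
  WithLp.toLp 2 fun j => y j

/-- `φ(z) = √(2/π) ∫_z^∞ (u - z)² exp(-u²/2) du`. -/
noncomputable def phi (z : ℝ) : ℝ :=
  √(2 / Real.pi) * ∫ u in Set.Ioi z, (u - z) ^ 2 * Real.exp (-u ^ 2 / 2)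

/-- The relative size `ρ_i = |P_i| / p`. -/
noncomputable def relSize {p L : ℕ} (P : Fin L → Finset (Fin p)) (i : Fin L) : ℝ :=
  ((P i).card : ℝ) / p

/-- The accuracy `α_i = |P_i ∩ S| / |P_i|`, where `S` is the support of `y`. -/
noncomputable def accuracy {p L : ℕ} (P : Fin L → Finset (Fin p)) (y : EuclideanSpace ℝ (Fin p))
    (i : Fin L) : ℝ :=
  ((P i ∩ vecSupport y).card : ℝ) / (P i).card

/-- The weight vector `D ω = ∑ i, ω_i 1_{P_i} ∈ ℝ^p`. -/
def blockWeights {p L : ℕ} (P : Fin L → Finset (Fin p)) (ω : Fin L → ℝ) (j : Fin p) : ℝ :=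
  ∑ i, if j ∈ P i then ω i else 0

/-- The normalized number `m_{p,s,w} = κ²(Ω) δ(𝒟(‖·‖_{1,w}, Ωx)) / p + 1 / p` of Gaussian
measurements required by the weighted `ℓ₁`-analysis program with weights `w`. -/
noncomputable def measWeighted {p n : ℕ} (Ω : Matrix (Fin p) (Fin n) ℝ)
    (x : EuclideanSpace ℝ (Fin n)) (w : Fin p → ℝ) : ℝ :=
  condNumber Ω ^ 2 *
    (statDim (descentCone (weightedL1 w) (Matrix.toEuclideanLin Ω x)) / p) + 1 / p

/-- The normalized number `κ²(Ω) δ(𝒟(‖·‖₁, (Ωx)_T)) / p + 1 / p` of Gaussian measurements required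
by the unweighted `ℓ₁` program for the piece `(Ωx)_T` alone. -/
noncomputable def measPiece {p n : ℕ} (Ω : Matrix (Fin p) (Fin n) ℝ)
    (x : EuclideanSpace ℝ (Fin n)) (T : Finset (Fin p)) : ℝ :=
  condNumber Ω ^ 2 *
    (statDim (descentCone (weightedL1 fun _ : T => (1 : ℝ))
      (subvector (Matrix.toEuclideanLin Ω x) T)) / p) + 1 / p

/-- `Ψ_{t,Dω} = ∑ i, ρ_i (α_i (t² ω_i² + 1) + (1 - α_i) φ(t ω_i))`. -/
noncomputable def Psi {p L : ℕ} (P : Fin L → Finset (Fin p)) (y : EuclideanSpace ℝ (Fin p))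
    (ω : Fin L → ℝ) (t : ℝ) : ℝ :=
  ∑ i, relSize P i *
    (accuracy P y i * (t ^ 2 * ω i ^ 2 + 1) + (1 - accuracy P y i) * phi (t * ω i))

/-- The quantity `κ²(Ω) inf_{t ≥ 0} Ψ_{t,Dω} + 1 / p` which the optimal weights minimize. -/
noncomputable def measUpper {p n L : ℕ} (Ω : Matrix (Fin p) (Fin n) ℝ)
    (x : EuclideanSpace ℝ (Fin n)) (P : Fin L → Finset (Fin p)) (ω : Fin L → ℝ) : ℝ :=
  condNumber Ω ^ 2 * sInf (Psi P (Matrix.toEuclideanLin Ω x) ω '' Set.Ici 0) + 1 / p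

/-- `ω` is a vector of optimal weights: it minimizes `measUpper` over `ℝ_+^L`. -/
def IsOptimalWeights {p n L : ℕ} (Ω : Matrix (Fin p) (Fin n) ℝ)
    (x : EuclideanSpace ℝ (Fin n)) (P : Fin L → Finset (Fin p)) (ω : Fin L → ℝ) : Prop :=
  (∀ i, 0 ≤ ω i) ∧
    ∀ ω' : Fin L → ℝ, (∀ i, 0 ≤ ω' i) → measUpper Ω x P ω ≤ measUpper Ω x P ω'

/-!
Write `y = Ω x`, and let `δ_i` be the statistical dimension of the descent cone of the `ℓ₁` norm at
the block `y_{P i}` and `δ` that of the block weighted norm at `y`. The term `(1 - L) / p` comes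
from the summands `1 / p`, so the claim compares `δ` with `∑ i, δ_i`.

**Lower bound.** A direction which does not increase the `ℓ₁` norm of one block, extended by zero,
does not increase the weighted norm. Hence a vector polar to the weighted descent cone restricts to
vectors polar to the block cones, the squared distance splits over the blocks, and
`∑ i, δ_i ≤ δ` for all nonnegative weights (`sum_statDim_le`); no error term is needed.

**Upper bound.** Every multiple `t ∂f(y)` of the subdifferential lies in the polar cone, so `δ` is
at most the expected squared distance to `t ∂f(y)`, which is `p Ψ_t` (`statDim_descentCone_le`,
`statDim_div_le_Psi`). As `Ψ_t(ω)` is a sum of functions of the single variables `t ω_i`, optimal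
weights minimize each block contribution separately (`IsOptimalWeights.sInf_Psi_le`). It remains to
see that the subdifferential bound is nearly sharp for one block with `q` entries, `s` of them
nonzero: some `τ ≥ 0` satisfies `s (τ² + 1) + (q - s) φ(τ) ≤ δ_i + 2 √(q / s)`
(`exists_le_statDim_add`).

For the latter, the polar cone of the `ℓ₁` descent cone is contained in `⋃ σ ≥ 0, σ ∂‖·‖₁(y)`. The
squared distance `F_g(σ)` from `g` to `σ ∂‖·‖₁(y)` satisfies
`F_g(σ) ≥ F_g(τ) + F_g'(τ) (σ - τ) + s (σ - τ)² ≥ F_g(τ) - F_g'(τ)² / (4 s)`. Choosing `τ` as the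
stationary point of `𝔼 F_g` makes `F_g'(τ)` a centred sum of independent variables, and summing
variances gives `𝔼 F_g'(τ)² ≤ 4 (s + (q - s) φ(τ))`. The resulting error `(s + (q - s) φ(τ)) / s`
is at most `q / s` because `φ ≤ 1`, and at most `3` because `z φ(z) ≤ 2 𝔼 (|g| - z)₊`
(`mul_phi_le`) and `s τ = (q - s) 𝔼 (|g| - τ)₊`. Finally `min (q / s) 3 ≤ 2 √(q / s)`.
-/

/-! ### Truncated moments of a standard Gaussian variable -/

/-- The excess `(|u| - z)₊` of `|u|` over the level `z`: the distance from `u` to `[-z, z]`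
when `0 ≤ z`. -/
noncomputable def excess (z u : ℝ) : ℝ := max (|u| - z) 0

lemma excess_nonneg (z u : ℝ) : 0 ≤ excess z u := le_max_right _ _

lemma excess_le_abs {z : ℝ} (hz : 0 ≤ z) (u : ℝ) : excess z u ≤ |u| :=
  max_le (by linarith) (abs_nonneg u)

lemma continuous_uncurry_excess : Continuous fun q : ℝ × ℝ => excess q.1 q.2 := by
  unfold excess; fun_prop

@[fun_prop]
lemma continuous_excess (z : ℝ) : Continuous (excess z) := by
  unfold excess; fun_prop

lemma integrable_sq_gaussian : Integrable (fun u : ℝ => u ^ 2) (gaussianReal 0 1) := by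
  have h : MemLp id 2 (gaussianReal 0 1) := memLp_id_gaussianReal 2
  simpa using h.integrable_sq

lemma integrable_abs_gaussian : Integrable (fun u : ℝ => |u|) (gaussianReal 0 1) := by
  have h : MemLp id 1 (gaussianReal 0 1) := memLp_id_gaussianReal 1
  simpa using (memLp_one_iff_integrable.1 h).abs

lemma integral_sq_gaussian : ∫ u : ℝ, u ^ 2 ∂(gaussianReal 0 1) = 1 := by
  have h := variance_eq_sub (memLp_id_gaussianReal (μ := 0) (v := 1) 2)
  rw [variance_id_gaussianReal] at h
  simp only [id, Pi.pow_apply, integral_id_gaussianReal] at h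
  simpa using h.symm

lemma memLp_excess {z : ℝ} (hz : 0 ≤ z) : MemLp (excess z) 2 (gaussianReal 0 1) := by
  have h : MemLp id 2 (gaussianReal 0 1) := memLp_id_gaussianReal 2
  refine h.mono (by fun_prop) (ae_of_all _ fun u => ?_)
  rw [Real.norm_of_nonneg (excess_nonneg z u)]
  exact excess_le_abs hz u

lemma integrable_excess {z : ℝ} (hz : 0 ≤ z) : Integrable (excess z) (gaussianReal 0 1) :=
  (memLp_excess hz).integrable one_le_two

lemma integrable_excess_sq {z : ℝ} (hz : 0 ≤ z) :
    Integrable (fun u => excess z u ^ 2) (gaussianReal 0 1) :=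
  (memLp_excess hz).integrable_sq

/-- Gaussian expectations of functions of `(|g| - z)₊` are one-sided Gaussian integrals. -/
lemma integral_comp_excess {z : ℝ} (hz : 0 ≤ z) (f : ℝ → ℝ) (hf : f 0 = 0) :
    ∫ u, f (excess z u) ∂(gaussianReal 0 1) =
      √(2 / Real.pi) * ∫ u in Set.Ioi z, f (u - z) * Real.exp (-u ^ 2 / 2) := by
  rw [integral_gaussianReal_eq_integral_smul one_ne_zero]
  have h1 : ∀ u : ℝ, gaussianPDFReal 0 1 u • f (excess z u) =
      (fun v => (√(2 * Real.pi))⁻¹ * (f (max (v - z) 0) * Real.exp (-v ^ 2 / 2))) |u| := by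
    intro u
    simp [gaussianPDFReal, excess]
    ring
  simp_rw [h1]
  rw [integral_comp_abs (f := fun v =>
    (√(2 * Real.pi))⁻¹ * (f (max (v - z) 0) * Real.exp (-v ^ 2 / 2))), integral_const_mul]
  have h2 : ∫ u in Set.Ioi (0 : ℝ), f (max (u - z) 0) * Real.exp (-u ^ 2 / 2) =
      ∫ u in Set.Ioi z, f (u - z) * Real.exp (-u ^ 2 / 2) := by
    rw [setIntegral_eq_of_subset_of_forall_sdiff_eq_zero measurableSet_Ioi
      (Set.Ioi_subset_Ioi hz) (f := fun u => f (max (u - z) 0) * Real.exp (-u ^ 2 / 2))]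
    · refine setIntegral_congr_fun measurableSet_Ioi fun u hu => ?_
      have : max (u - z) 0 = u - z := max_eq_left (by have := Set.mem_Ioi.1 hu; linarith)
      simp only [this]
    · rintro u ⟨-, hu⟩
      have : max (u - z) 0 = 0 := max_eq_right (by have := Set.notMem_Ioi.1 hu; linarith)
      simp [this, hf]
  rw [h2, ← mul_assoc]
  congr 1
  rw [Real.sqrt_mul (by norm_num), Real.sqrt_div (by norm_num)]
  have h3 : √(2 : ℝ) * √2 = 2 := Real.mul_self_sqrt (by norm_num)
  have h4 : √Real.pi ≠ 0 := by positivity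
  field_simp
  nlinarith

lemma phi_eq_integral_excess {z : ℝ} (hz : 0 ≤ z) :
    phi z = ∫ u, excess z u ^ 2 ∂(gaussianReal 0 1) :=
  (integral_comp_excess hz (fun v => v ^ 2) (by simp)).symm

lemma phi_nonneg {z : ℝ} (hz : 0 ≤ z) : 0 ≤ phi z := by
  rw [phi_eq_integral_excess hz]
  exact integral_nonneg fun u => sq_nonneg _

lemma phi_le_one {z : ℝ} (hz : 0 ≤ z) : phi z ≤ 1 := by
  rw [phi_eq_integral_excess hz, ← integral_sq_gaussian]
  refine integral_mono (integrable_excess_sq hz) integrable_sq_gaussian fun u => ?_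
  simpa using pow_le_pow_left₀ (excess_nonneg z u) (excess_le_abs hz u) 2

lemma continuousOn_phi : ContinuousOn phi (Set.Ici 0) := by
  refine ContinuousOn.congr (f := fun z => ∫ u, excess z u ^ 2 ∂(gaussianReal 0 1)) ?_
    fun z hz => phi_eq_integral_excess hz
  refine continuousOn_of_dominated (bound := fun u => u ^ 2) (fun z _ => by fun_prop)
    (fun z hz => ae_of_all _ fun u => ?_) integrable_sq_gaussian (ae_of_all _ fun u => ?_)
  · rw [Real.norm_of_nonneg (sq_nonneg _)]
    simpa using pow_le_pow_left₀ (excess_nonneg z u) (excess_le_abs hz u) 2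
  · exact ((continuous_uncurry_excess.comp (Continuous.prodMk_left u)).pow 2).continuousOn

lemma continuousOn_integral_excess :
    ContinuousOn (fun z => ∫ u, excess z u ∂(gaussianReal 0 1)) (Set.Ici 0) := by
  refine continuousOn_of_dominated (bound := fun u => |u|) (fun z _ => by fun_prop)
    (fun z hz => ae_of_all _ fun u => ?_) integrable_abs_gaussian (ae_of_all _ fun u => ?_)
  · rw [Real.norm_of_nonneg (excess_nonneg z u)]
    exact excess_le_abs hz u
  · exact (continuous_uncurry_excess.comp (Continuous.prodMk_left u)).continuousOn

lemma integrable_pow_mul_exp (k : ℕ) :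
    Integrable fun u : ℝ => u ^ k * Real.exp (-u ^ 2 / 2) := by
  have h := integrable_rpow_mul_exp_neg_mul_sq (b := 1 / 2) (by norm_num) (s := k)
    (by have : (0 : ℝ) ≤ k := k.cast_nonneg
        linarith)
  refine h.congr (ae_of_all _ fun u => ?_)
  simp only [Real.rpow_natCast]
  congr 2
  ring

/-- The hazard-type inequality `z 𝔼(|g| - z)₊² ≤ 2 𝔼(|g| - z)₊`, obtained by integrating the
derivative of `(u - z)² exp(-u²/2)` over `(z, ∞)`. -/
lemma mul_phi_le {z : ℝ} (hz : 0 ≤ z) :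
    z * phi z ≤ 2 * ∫ u, excess z u ∂(gaussianReal 0 1) := by
  have hint : ∀ a b c d : ℝ, Integrable fun u : ℝ =>
      (a * u ^ 3 + b * u ^ 2 + c * u + d) * Real.exp (-u ^ 2 / 2) := by
    intro a b c d
    refine (((((integrable_pow_mul_exp 3).const_mul a).add
      ((integrable_pow_mul_exp 2).const_mul b)).add
      ((integrable_pow_mul_exp 1).const_mul c)).add
      ((integrable_pow_mul_exp 0).const_mul d)).congr (ae_of_all _ fun u => ?_)
    simp
    ring
  have i0 : Integrable fun u : ℝ => (u - z) ^ 2 * Real.exp (-u ^ 2 / 2) := by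
    refine (hint 0 1 (-2 * z) (z ^ 2)).congr (ae_of_all _ fun u => ?_)
    simp only
    ring
  have i1 : Integrable fun u : ℝ => (u - z) * Real.exp (-u ^ 2 / 2) := by
    refine (hint 0 0 1 (-z)).congr (ae_of_all _ fun u => ?_)
    simp only
    ring
  have i2 : Integrable fun u : ℝ => (2 * (u - z) - u * (u - z) ^ 2) * Real.exp (-u ^ 2 / 2) := by
    refine (hint (-1) (2 * z) (2 - z ^ 2) (-2 * z)).congr (ae_of_all _ fun u => ?_)
    simp only
    ring
  have hd : ∀ u : ℝ, HasDerivAt (fun u : ℝ => (u - z) ^ 2 * Real.exp (-u ^ 2 / 2))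
      ((2 * (u - z) - u * (u - z) ^ 2) * Real.exp (-u ^ 2 / 2)) u := by
    intro u
    have h1 := (((hasDerivAt_id u).sub_const z).pow 2).mul
      (((((hasDerivAt_id u).pow 2).neg).div_const 2).exp)
    refine h1.congr_deriv ?_
    simp
    ring
  have h0 := integral_Ioi_of_hasDerivAt_of_tendsto' (a := z) (fun u _ => hd u) i2.integrableOn
    (tendsto_zero_of_hasDerivAt_of_integrableOn_Ioi (a := z) (fun u _ => hd u)
      i2.integrableOn i0.integrableOn)
  rw [phi_eq_integral_excess hz, integral_comp_excess hz (fun v => v ^ 2) (by simp),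
    integral_comp_excess hz (fun v => v) rfl]
  have key : z * ∫ u in Set.Ioi z, (u - z) ^ 2 * Real.exp (-u ^ 2 / 2) ≤
      2 * ∫ u in Set.Ioi z, (u - z) * Real.exp (-u ^ 2 / 2) := by
    rw [← sub_nonneg, ← integral_const_mul, ← integral_const_mul,
      ← integral_sub (i1.const_mul 2).integrableOn (i0.const_mul z).integrableOn]
    refine le_trans (by simp [h0]) (setIntegral_mono_on i2.integrableOn
      ((i1.const_mul 2).sub (i0.const_mul z)).integrableOn measurableSet_Ioi fun u hu => ?_)
    have h2 : 0 ≤ (u - z) * ((u - z) ^ 2 * Real.exp (-u ^ 2 / 2)) :=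
      mul_nonneg (sub_nonneg.2 (le_of_lt hu)) (by positivity)
    nlinarith
  have := mul_le_mul_of_nonneg_left key (Real.sqrt_nonneg (2 / Real.pi))
  linarith

/-! ### Coordinates of a standard Gaussian vector -/

section Coordinates

variable {ι : Type*} [Fintype ι]

lemma measurePreserving_toLp_stdGaussian :
    MeasurePreserving (WithLp.toLp 2) (Measure.pi fun _ : ι => gaussianReal 0 1)
      (stdGaussian (EuclideanSpace ℝ ι)) :=
  ⟨by fun_prop, map_pi_eq_stdGaussian⟩

lemma measurePreserving_ofLp_stdGaussian :
    MeasurePreserving (WithLp.ofLp : EuclideanSpace ℝ ι → ι → ℝ)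
      (stdGaussian (EuclideanSpace ℝ ι)) (Measure.pi fun _ : ι => gaussianReal 0 1) :=
  MeasurePreserving.symm (MeasurableEquiv.toLp 2 (ι → ℝ)) measurePreserving_toLp_stdGaussian

lemma measurePreserving_coord (j : ι) :
    MeasurePreserving (fun g : EuclideanSpace ℝ ι => g j)
      (stdGaussian (EuclideanSpace ℝ ι)) (gaussianReal 0 1) :=
  (measurePreserving_eval (fun _ : ι => gaussianReal 0 1) j).comp
    measurePreserving_ofLp_stdGaussian

/-- The restriction of a standard Gaussian vector to a set of coordinates is standard Gaussian. -/
lemma measurePreserving_subvector {p : ℕ} (T : Finset (Fin p)) :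
    MeasurePreserving (fun g : EuclideanSpace ℝ (Fin p) => subvector g T)
      (stdGaussian (EuclideanSpace ℝ (Fin p))) (stdGaussian (EuclideanSpace ℝ T)) := by
  have h := (measurePreserving_fst.comp (measurePreserving_piEquivPiSubtypeProd
    (fun _ : Fin p => gaussianReal 0 1) (fun j => j ∈ T))).comp measurePreserving_ofLp_stdGaussian
  rw [Subsingleton.elim (Subtype.fintype fun j => j ∈ T) (Finset.Subtype.fintype T)] at h
  exact measurePreserving_toLp_stdGaussian.comp h

lemma integrable_sum_coord {h : ι → ℝ → ℝ} (hh : ∀ j, Integrable (h j) (gaussianReal 0 1)) :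
    Integrable (fun g : EuclideanSpace ℝ ι => ∑ j, h j (g j)) (stdGaussian _) :=
  integrable_finsetSum _ fun j _ => (measurePreserving_coord j).integrable_comp_of_integrable (hh j)

lemma integral_sum_coord {h : ι → ℝ → ℝ} (hh : ∀ j, Integrable (h j) (gaussianReal 0 1)) :
    ∫ g : EuclideanSpace ℝ ι, ∑ j, h j (g j) ∂(stdGaussian _) =
      ∑ j, ∫ u, h j u ∂(gaussianReal 0 1) := by
  have hint : ∀ j, Integrable (fun g : EuclideanSpace ℝ ι => h j (g j)) (stdGaussian _) :=
    fun j => (measurePreserving_coord j).integrable_comp_of_integrable (hh j)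
  rw [integral_finsetSum _ fun j _ => hint j]
  refine Finset.sum_congr rfl fun j _ => ?_
  rw [← (measurePreserving_coord j).map_eq, integral_map (by fun_prop)]
  rw [(measurePreserving_coord j).map_eq]
  exact (hh j).aestronglyMeasurable

lemma integrable_sq_sum_coord {h : ι → ℝ → ℝ} (hh : ∀ j, MemLp (h j) 2 (gaussianReal 0 1)) :
    Integrable (fun g : EuclideanSpace ℝ ι => (∑ j, h j (g j)) ^ 2) (stdGaussian _) :=
  (memLp_finsetSum _ fun j _ => (hh j).comp_measurePreserving
    (measurePreserving_coord j)).integrable_sq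

/-- The second moment of a centred sum of functions of the individual coordinates of a standard
Gaussian vector is the sum of the variances. -/
lemma integral_sq_sum_coord {h : ι → ℝ → ℝ} (hh : ∀ j, MemLp (h j) 2 (gaussianReal 0 1))
    (h0 : ∑ j, ∫ u, h j u ∂(gaussianReal 0 1) = 0) :
    ∫ g : EuclideanSpace ℝ ι, (∑ j, h j (g j)) ^ 2 ∂(stdGaussian _) =
      ∑ j, Var[h j; gaussianReal 0 1] := by
  have hpi : ∀ j, MemLp (fun x : ι → ℝ => h j (x j)) 2
      (Measure.pi fun _ : ι => gaussianReal 0 1) := fun j =>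
    (hh j).comp_measurePreserving (measurePreserving_eval (fun _ : ι => gaussianReal 0 1) j)
  have hmean : ∫ x : ι → ℝ, ∑ j, h j (x j) ∂(Measure.pi fun _ : ι => gaussianReal 0 1) = 0 := by
    rw [integral_finsetSum _ fun j _ => (hpi j).integrable one_le_two]
    refine (Finset.sum_congr rfl fun j _ => ?_).trans h0
    exact integral_comp_eval (hh j).aestronglyMeasurable
  have hmap : ∫ g : EuclideanSpace ℝ ι, (∑ j, h j (g j)) ^ 2 ∂(stdGaussian _) =
      ∫ x : ι → ℝ, (∑ j, h j (x j)) ^ 2 ∂(Measure.pi fun _ : ι => gaussianReal 0 1) :=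
    measurePreserving_ofLp_stdGaussian.integral_comp
      (MeasurableEquiv.toLp 2 (ι → ℝ)).symm.measurableEmbedding
      (fun x : ι → ℝ => (∑ j, h j (x j)) ^ 2)
  rw [hmap, ← variance_sum_pi hh, variance_eq_sub]
  · simp [Finset.sum_apply, hmean]
  · exact memLp_finsetSum' _ fun j _ => hpi j

end Coordinates

/-! ### Statistical dimension and polar cones -/

section Cones

variable {ι : Type*} [Fintype ι]

lemma zero_mem_polarCone {E : Type*} [NormedAddCommGroup E] [InnerProductSpace ℝ E] (C : Set E) :
    (0 : E) ∈ polarCone C := fun z _ => by simp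

lemma le_infDist_sq {E : Type*} [PseudoMetricSpace E] {s : Set E} (hs : s.Nonempty) {g : E}
    {c : ℝ} (h : ∀ u ∈ s, c ≤ dist g u ^ 2) : c ≤ Metric.infDist g s ^ 2 := by
  rcases le_or_gt c 0 with hc | hc
  · exact hc.trans (sq_nonneg _)
  · have h1 : √c ≤ Metric.infDist g s :=
      (Metric.le_infDist hs).2 fun u hu => Real.sqrt_le_iff.2 ⟨dist_nonneg, h u hu⟩
    simpa [Real.sq_sqrt hc.le] using pow_le_pow_left₀ (Real.sqrt_nonneg c) h1 2

lemma integrable_infDist_sq (C : Set (EuclideanSpace ℝ ι)) :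
    Integrable (fun g => Metric.infDist g (polarCone C) ^ 2)
      (stdGaussian (EuclideanSpace ℝ ι)) := by
  have h : MemLp id 2 (stdGaussian (EuclideanSpace ℝ ι)) := IsGaussian.memLp_two_id
  refine (h.mono (f := fun g => Metric.infDist g (polarCone C))
    (Metric.continuous_infDist_pt _).aestronglyMeasurable
    (ae_of_all _ fun g => ?_)).integrable_sq
  rw [Real.norm_of_nonneg Metric.infDist_nonneg]
  simpa using Metric.infDist_le_dist_of_mem (x := g) (zero_mem_polarCone C)

lemma Real.sign_mul_self_eq_abs (a : ℝ) : Real.sign a * a = |a| := by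
  rcases lt_trichotomy a 0 with h | h | h
  · simp [Real.sign_of_neg h, abs_of_neg h]
  · simp [h]
  · simp [Real.sign_of_pos h, abs_of_pos h]

lemma Real.sign_mul_sign {a : ℝ} (ha : a ≠ 0) : Real.sign a * Real.sign a = 1 := by
  rcases Real.sign_apply_eq_of_ne_zero a ha with h | h <;> simp [h]

lemma Real.sign_mul_le_abs {a : ℝ} (b : ℝ) : Real.sign a * b ≤ |b| := by
  rcases Real.sign_apply_eq a with h | h | h <;> simp [h, neg_le_abs, le_abs_self]

lemma inner_euclidean (u z : EuclideanSpace ℝ ι) : inner ℝ u z = ∑ j, u j * z j := by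
  simp [PiLp.inner_apply, mul_comm]

lemma dist_sq_euclidean (g u : EuclideanSpace ℝ ι) : dist g u ^ 2 = ∑ j, (g j - u j) ^ 2 := by
  rw [dist_eq_norm, EuclideanSpace.real_norm_sq_eq]
  simp

/-- Every nonnegative multiple `t ∂f(y)` of the subdifferential of `f = ‖·‖_{1,w}` lies in the
polar of the descent cone of `f` at `y`. -/
lemma mem_polarCone_descentCone {w : ι → ℝ} {y u : EuclideanSpace ℝ ι} {t : ℝ} (ht : 0 ≤ t)
    (hw : ∀ j, 0 ≤ w j) (hu : ∀ j, y j ≠ 0 → u j = t * w j * Real.sign (y j))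
    (hu0 : ∀ j, y j = 0 → |u j| ≤ t * w j) :
    u ∈ polarCone (descentCone (weightedL1 w) y) := by
  rintro z ⟨r, hr, hz⟩
  have h : ∀ j, r * (u j * z j) ≤ t * (w j * |y j + r * z j| - w j * |y j|) := by
    intro j
    have htw : 0 ≤ t * w j := mul_nonneg ht (hw j)
    by_cases hj : y j = 0
    · have h1 : r * (u j * z j) ≤ |u j| * |r * z j| := by
        rw [← abs_mul]
        exact (le_of_eq (by ring)).trans (le_abs_self _)
      have h2 := mul_le_mul_of_nonneg_right (hu0 j hj) (abs_nonneg (r * z j))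
      simp only [hj, zero_add, abs_zero]
      linarith
    · have h1 := mul_le_mul_of_nonneg_left
        (Real.sign_mul_le_abs (a := y j) (y j + r * z j)) htw
      have h2 := Real.sign_mul_self_eq_abs (y j)
      rw [hu j hj, ← h2]
      nlinarith
  have hsum : r * inner ℝ u z ≤ t * (weightedL1 w (y + r • z) - weightedL1 w y) := by
    rw [inner_euclidean, Finset.mul_sum, weightedL1, weightedL1, ← Finset.sum_sub_distrib,
      Finset.mul_sum]
    exact Finset.sum_le_sum fun j _ => by simpa using h j
  have := mul_nonpos_of_nonneg_of_nonpos ht (sub_nonpos.2 hz)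
  exact nonpos_of_mul_nonpos_right (hsum.trans this) hr

/-- The vectors in the polar of the descent cone of the `ℓ₁` norm at `y ≠ 0` are multiples of
subgradients at `y`. -/
lemma exists_of_mem_polarCone_descentCone {y u : EuclideanSpace ℝ ι}
    (hu : u ∈ polarCone (descentCone (weightedL1 fun _ : ι => (1 : ℝ)) y))
    (hy : ∃ k, y k ≠ 0) :
    ∃ σ : ℝ, (∀ j, y j ≠ 0 → Real.sign (y j) * u j = σ) ∧ ∀ j, |u j| ≤ σ := by
  classical
  -- Moving mass from the coordinate `k` to the coordinate `j` does not increase the `ℓ₁` norm.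
  have hdesc : ∀ k j : ι, ∀ ε : ℝ, |ε| = 1 →
      EuclideanSpace.single j (ε * |y k|) - EuclideanSpace.single k (y k) ∈
        descentCone (weightedL1 fun _ : ι => (1 : ℝ)) y := by
    intro k j ε hε
    refine ⟨1, one_pos, ?_⟩
    have h : ∀ i, |(y + (1 : ℝ) • (EuclideanSpace.single j (ε * |y k|) -
        EuclideanSpace.single k (y k))) i| ≤
        |y i| + ((if i = j then |y k| else 0) - if i = k then |y k| else 0) := by
      intro i
      have h1 : (y + (1 : ℝ) • (EuclideanSpace.single j (ε * |y k|) -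
        EuclideanSpace.single k (y k))) i =
          (y i - if i = k then y k else 0) + if i = j then ε * |y k| else 0 := by
        simp
        ring
      rw [h1]
      refine (abs_add_le _ _).trans ?_
      have h2 : |y i - if i = k then y k else 0| = |y i| - if i = k then |y k| else 0 := by
        split_ifs with hik
        · simp [hik]
        · simp
      have h3 : |if i = j then ε * |y k| else 0| = if i = j then |y k| else 0 := by
        split_ifs
        · rw [abs_mul, hε, abs_abs, one_mul]
        · simp
      rw [h2, h3]
      linarith
    simp only [weightedL1, one_mul]
    refine (Finset.sum_le_sum fun i _ => h i).trans (le_of_eq ?_)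
    simp [Finset.sum_add_distrib]
  have hineq : ∀ k j : ι, |u j| * |y k| ≤ u k * y k := by
    intro k j
    have h : ∀ ε : ℝ, |ε| = 1 → ε * u j * |y k| ≤ u k * y k := by
      intro ε hε
      have h1 := hu _ (hdesc k j ε hε)
      rw [inner_sub_right, EuclideanSpace.inner_single_right,
        EuclideanSpace.inner_single_right] at h1
      simp only [conj_trivial] at h1
      linarith
    rcases abs_choice (u j) with h1 | h1 <;> rw [h1]
    · simpa using h 1 (by simp)
    · simpa using h (-1) (by simp)
  obtain ⟨k, hk⟩ := hy
  have hle : ∀ j, |u j| ≤ |u k| := fun j => by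
    have h1 := (hineq k j).trans (le_abs_self _)
    rw [abs_mul] at h1
    exact le_of_mul_le_mul_right h1 (abs_pos.2 hk)
  refine ⟨|u k|, fun j hj => le_antisymm ((Real.sign_mul_le_abs _).trans (hle j)) ?_, hle⟩
  refine le_of_mul_le_mul_right ((hineq j k).trans (le_of_eq ?_)) (abs_pos.2 hj)
  rw [← Real.sign_mul_self_eq_abs (y j)]
  linear_combination (-u j * y j) * Real.sign_mul_sign hj

/-! ### The distance to a multiple of the subdifferential -/

/-- For `τ ≥ 0`, the absolute value of `subdiffResidual a τ u` is the distance from `u` to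
`τ ∂|·|(a)`. -/
noncomputable def subdiffResidual (a τ u : ℝ) : ℝ :=
  if a ≠ 0 then Real.sign a * u - τ else excess τ u

lemma subdiffResidual_of_ne {a : ℝ} (ha : a ≠ 0) (τ : ℝ) :
    subdiffResidual a τ = fun u => Real.sign a * u - τ := by
  ext u; simp [subdiffResidual, ha]

lemma subdiffResidual_zero (τ : ℝ) : subdiffResidual 0 τ = excess τ := by
  ext u; simp [subdiffResidual]

lemma memLp_subdiffResidual (a : ℝ) {τ : ℝ} (hτ : 0 ≤ τ) :
    MemLp (subdiffResidual a τ) 2 (gaussianReal 0 1) := by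
  by_cases ha : a = 0
  · rw [ha, subdiffResidual_zero]
    exact memLp_excess hτ
  · rw [subdiffResidual_of_ne ha]
    exact ((memLp_id_gaussianReal 2).const_mul _).sub (memLp_const τ)

lemma integral_subdiffResidual_of_ne {a : ℝ} (ha : a ≠ 0) (τ : ℝ) :
    ∫ u, subdiffResidual a τ u ∂(gaussianReal 0 1) = -τ := by
  have hi : Integrable (fun u : ℝ => u) (gaussianReal 0 1) :=
    (memLp_id_gaussianReal (μ := 0) (v := 1) 1).integrable le_rfl
  rw [subdiffResidual_of_ne ha, integral_sub (hi.const_mul _) (integrable_const _),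
    integral_const_mul]
  simp [integral_id_gaussianReal]

lemma variance_subdiffResidual_of_ne {a : ℝ} (ha : a ≠ 0) (τ : ℝ) :
    Var[subdiffResidual a τ; gaussianReal 0 1] = 1 := by
  have hm : AEStronglyMeasurable (fun u : ℝ => Real.sign a * u) (gaussianReal 0 1) := by fun_prop
  rw [subdiffResidual_of_ne ha, variance_sub_const hm, variance_const_mul,
    variance_fun_id_gaussianReal, pow_two, Real.sign_mul_sign ha]
  simp

lemma integral_subdiffResidual_sq (a : ℝ) {τ : ℝ} (hτ : 0 ≤ τ) :
    ∫ u, subdiffResidual a τ u ^ 2 ∂(gaussianReal 0 1) = if a ≠ 0 then τ ^ 2 + 1 else phi τ := by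
  by_cases ha : a = 0
  · rw [ha, subdiffResidual_zero, phi_eq_integral_excess hτ]
    simp
  · have h := variance_eq_sub (memLp_subdiffResidual a hτ)
    rw [variance_subdiffResidual_of_ne ha, integral_subdiffResidual_of_ne ha] at h
    simp only [Pi.pow_apply] at h
    rw [if_pos ha]
    linarith

lemma variance_subdiffResidual_le (a : ℝ) {τ : ℝ} (hτ : 0 ≤ τ) :
    Var[subdiffResidual a τ; gaussianReal 0 1] ≤ if a ≠ 0 then 1 else phi τ := by
  by_cases ha : a = 0
  · refine (variance_le_expectation_sq (memLp_subdiffResidual a hτ).aestronglyMeasurable).trans ?_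
    simpa [ha] using (integral_subdiffResidual_sq a hτ).le
  · simp [variance_subdiffResidual_of_ne ha, ha]

/-- The point of `τ ∂|·|(a)` nearest to `v`: the subdifferential is a singleton if `a ≠ 0` and
`[-1, 1]` if `a = 0`. -/
lemma exists_sub_sq_eq_subdiffResidual_sq (a : ℝ) {τ : ℝ} (hτ : 0 ≤ τ) (v : ℝ) :
    ∃ u : ℝ, (a ≠ 0 → u = τ * Real.sign a) ∧ (a = 0 → |u| ≤ τ) ∧
      (v - u) ^ 2 = subdiffResidual a τ v ^ 2 := by
  by_cases ha : a = 0
  · subst ha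
    rw [subdiffResidual_zero, excess]
    rcases le_total |v| τ with h | h
    · exact ⟨v, by simp, fun _ => h, by rw [max_eq_right (by linarith)]; ring⟩
    · rw [max_eq_left (by linarith)]
      rcases abs_cases v with ⟨h1, h2⟩ | ⟨h1, h2⟩
      · exact ⟨τ, by simp, fun _ => (abs_of_nonneg hτ).le, by rw [h1]⟩
      · exact ⟨-τ, by simp, fun _ => by rw [abs_neg, abs_of_nonneg hτ], by rw [h1]; ring⟩
  · refine ⟨τ * Real.sign a, fun _ => rfl, fun h => absurd h ha, ?_⟩
    rw [subdiffResidual_of_ne ha]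
    linear_combination (τ ^ 2 - v ^ 2) * Real.sign_mul_sign ha

/-- The statistical dimension of a descent cone is at most the expected squared distance to any
fixed multiple of the subdifferential. -/
lemma statDim_descentCone_le {w : ι → ℝ} (hw : ∀ j, 0 ≤ w j) (y : EuclideanSpace ℝ ι) {t : ℝ}
    (ht : 0 ≤ t) :
    statDim (descentCone (weightedL1 w) y) ≤
      ∑ j, if y j ≠ 0 then (t * w j) ^ 2 + 1 else phi (t * w j) := by
  have htw : ∀ j, 0 ≤ t * w j := fun j => mul_nonneg ht (hw j)
  have hint : ∀ j, Integrable (fun u => subdiffResidual (y j) (t * w j) u ^ 2) (gaussianReal 0 1) :=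
    fun j => (memLp_subdiffResidual (y j) (htw j)).integrable_sq
  rw [← Finset.sum_congr rfl fun j _ => integral_subdiffResidual_sq (y j) (htw j),
    ← integral_sum_coord hint]
  refine integral_mono (integrable_infDist_sq _) (integrable_sum_coord hint) fun g => ?_
  choose u h1 h2 h3 using fun j => exists_sub_sq_eq_subdiffResidual_sq (y j) (htw j) (g j)
  have hmem : WithLp.toLp 2 u ∈ polarCone (descentCone (weightedL1 w) y) :=
    mem_polarCone_descentCone ht hw h1 h2
  refine (pow_le_pow_left₀ Metric.infDist_nonneg (Metric.infDist_le_dist_of_mem hmem) 2).trans ?_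
  rw [dist_sq_euclidean]
  exact (Finset.sum_congr rfl fun j _ => h3 j).le

end Cones

/-! ### The error of the subdifferential bound for the `ℓ₁` norm -/

lemma integral_excess_zero_pos : 0 < ∫ u, excess 0 u ∂(gaussianReal 0 1) := by
  refine lt_of_le_of_ne (integral_nonneg fun u => excess_nonneg 0 u) fun h => ?_
  have h1 := (integral_eq_zero_iff_of_nonneg (fun u => excess_nonneg 0 u)
    (integrable_excess le_rfl)).1 h.symm
  have h2 : ∫ u : ℝ, u ^ 2 ∂(gaussianReal 0 1) = 0 := by
    refine integral_eq_zero_of_ae ?_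
    filter_upwards [h1] with u hu
    simpa [excess] using hu
  rw [integral_sq_gaussian] at h2
  exact one_ne_zero h2

/-- The stationarity equation of `τ ↦ s (τ² + 1) + (q - s) φ(τ)` has a nonnegative solution. -/
lemma exists_stationary {s q : ℝ} (hs : 0 < s) (hsq : s ≤ q) :
    ∃ τ, 0 ≤ τ ∧ s * τ = (q - s) * ∫ u, excess τ u ∂(gaussianReal 0 1) := by
  set e : ℝ → ℝ := fun τ => ∫ u, excess τ u ∂(gaussianReal 0 1) with he
  set m : ℝ := ∫ u : ℝ, |u| ∂(gaussianReal 0 1)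
  have hm : 0 ≤ m := integral_nonneg fun u => abs_nonneg u
  have hR : 0 ≤ (q - s) * m / s := div_nonneg (mul_nonneg (by linarith) hm) hs.le
  have hcont : ContinuousOn (fun τ => s * τ - (q - s) * e τ) (Set.Icc 0 ((q - s) * m / s)) :=
    (continuousOn_const.mul continuousOn_id).sub (continuousOn_const.mul
      (continuousOn_integral_excess.mono fun x hx => hx.1))
  have h0 : s * 0 - (q - s) * e 0 ≤ 0 := by
    have := mul_nonneg (sub_nonneg.2 hsq) integral_excess_zero_pos.le
    simp only [he]
    linarith
  have h1 : 0 ≤ s * ((q - s) * m / s) - (q - s) * e ((q - s) * m / s) := by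
    have h2 : e ((q - s) * m / s) ≤ m :=
      integral_mono (integrable_excess hR) integrable_abs_gaussian fun u => excess_le_abs hR u
    have h3 := mul_le_mul_of_nonneg_left h2 (sub_nonneg.2 hsq)
    rw [mul_div_cancel₀ _ hs.ne']
    linarith
  obtain ⟨τ, hτ, h⟩ := intermediate_value_Icc hR hcont ⟨h0, h1⟩
  exact ⟨τ, hτ.1, by simp only at h; linarith⟩

/-- At the stationary point, the variance term divided by the modulus of strong convexity is at
most `min (q / s) 3`, hence at most `2 √(q / s)`. -/
lemma stationary_error_le {s q τ : ℝ} (hs : 0 < s) (hsq : s ≤ q) (hτ : 0 ≤ τ)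
    (h : s * τ = (q - s) * ∫ u, excess τ u ∂(gaussianReal 0 1)) :
    (s + (q - s) * phi τ) / s ≤ 2 * √(q / s) := by
  have hqs : 0 ≤ q - s := sub_nonneg.2 hsq
  have h1 : (s + (q - s) * phi τ) / s ≤ q / s := by
    have := mul_le_mul_of_nonneg_left (phi_le_one hτ) hqs
    gcongr
    linarith
  have h3 : (s + (q - s) * phi τ) / s ≤ 3 := by
    rw [div_le_iff₀ hs]
    rcases hτ.eq_or_lt with rfl | hpos
    · have : q - s = 0 := by
        have := integral_excess_zero_pos.ne'
        simpa [this] using h.symm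
      rw [this]
      linarith
    · have h2 := mul_le_mul_of_nonneg_left (mul_phi_le hτ) hqs
      have : (q - s) * phi τ ≤ 2 * s := by
        refine le_of_mul_le_mul_left ?_ hpos
        linarith
      linarith
  have hr1 : 1 ≤ √(q / s) := by
    rw [Real.one_le_sqrt, le_div_iff₀ hs]
    linarith
  have hr : √(q / s) ^ 2 = q / s := Real.sq_sqrt (div_nonneg (hs.le.trans hsq) hs.le)
  rcases le_total (√(q / s)) 2 with h2 | h2
  · nlinarith
  · linarith

section Block

variable {ι : Type*} [Fintype ι]

lemma sum_ite_ne_zero (y : EuclideanSpace ℝ ι) (a b : ℝ) :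
    ∑ j, (if y j ≠ 0 then a else b) =
      (Finset.univ.filter fun j => y j ≠ 0).card * a +
        ((Fintype.card ι : ℝ) - (Finset.univ.filter fun j => y j ≠ 0).card) * b := by
  have hc : ((Finset.univ.filter fun j => y j ≠ 0).card : ℝ) +
      (Finset.univ.filter fun j => ¬ y j ≠ 0).card = Fintype.card ι := by
    exact_mod_cast Finset.card_filter_add_card_filter_not (s := Finset.univ) fun j => y j ≠ 0
  rw [Finset.sum_ite, Finset.sum_const, Finset.sum_const, nsmul_eq_mul, nsmul_eq_mul, ← hc]
  ring

/-- A quadratic lower bound, expanded at `τ`, for the squared distance of `v` to a polar entry `u`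
with multiplier `σ`: an identity where `a ≠ 0`, and convexity of `σ ↦ (|v| - σ)₊²` where
`a = 0`. -/
lemma sq_subdiffResidual_le {a σ u : ℝ} (τ v : ℝ) (ha : a ≠ 0 → Real.sign a * u = σ)
    (hu : |u| ≤ σ) :
    subdiffResidual a τ v ^ 2 - 2 * subdiffResidual a τ v * (σ - τ) +
      (if a ≠ 0 then 1 else 0) * (σ - τ) ^ 2 ≤ (v - u) ^ 2 := by
  by_cases h : a = 0
  · have h1 : excess σ v ^ 2 ≤ (v - u) ^ 2 := by
      rw [← sq_abs (v - u)]
      refine pow_le_pow_left₀ (excess_nonneg _ _) (max_le ?_ (abs_nonneg _)) 2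
      have := abs_sub_abs_le_abs_sub v u
      linarith
    have h2 : excess τ v ^ 2 - 2 * excess τ v * (σ - τ) ≤ excess σ v ^ 2 := by
      have hs := excess_nonneg σ v
      have ht := excess_nonneg τ v
      have hs' : |v| - σ ≤ excess σ v := le_max_left _ _
      rcases max_choice (|v| - τ) 0 with h3 | h3
      · have h4 : excess τ v = |v| - τ := h3
        nlinarith [sq_nonneg (excess τ v - excess σ v)]
      · have h4 : excess τ v = 0 := h3
        rw [h4]
        nlinarith
    rw [h, subdiffResidual_zero]
    simp only [ne_eq, not_true_eq_false, if_false, zero_mul, add_zero]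
    linarith
  · rw [subdiffResidual_of_ne h, if_pos h, ← ha h]
    refine le_of_eq ?_
    linear_combination (v - u) ^ 2 * Real.sign_mul_sign h

/-- The subdifferential bound for the `ℓ₁` norm is accurate up to `2 √(q / s)`, where `s` is the
number of nonzero entries of `y ∈ ℝ^q`. The squared distance `F_g(σ)` of `g` to `σ ∂‖·‖₁(y)` is
strongly convex in `σ` with modulus `2 s`, so `inf F_g ≥ F_g(τ) - F_g'(τ)² / (4 s)`; at the
stationary point `τ` of `𝔼 F_g` the expectation of `F_g'(τ)²` is a sum of variances. -/
lemma exists_le_statDim_add (y : EuclideanSpace ℝ ι) (hy : ∃ k, y k ≠ 0) :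
    ∃ τ : ℝ, 0 ≤ τ ∧
      (Finset.univ.filter fun j => y j ≠ 0).card * (τ ^ 2 + 1) +
          ((Fintype.card ι : ℝ) - (Finset.univ.filter fun j => y j ≠ 0).card) * phi τ ≤
        statDim (descentCone (weightedL1 fun _ : ι => (1 : ℝ)) y) +
          2 * √((Fintype.card ι : ℝ) / (Finset.univ.filter fun j => y j ≠ 0).card) := by
  set s : ℝ := ((Finset.univ.filter fun j => y j ≠ 0).card : ℝ) with hsdef
  set q : ℝ := (Fintype.card ι : ℝ) with hqdef
  have hs : 0 < s := by
    obtain ⟨k, hk⟩ := hy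
    rw [hsdef, Nat.cast_pos, Finset.card_pos]
    exact ⟨k, by simpa using hk⟩
  have hsq : s ≤ q := by
    rw [hsdef, hqdef]
    exact_mod_cast Finset.card_le_univ _
  obtain ⟨τ, hτ, hstat⟩ := exists_stationary hs hsq
  refine ⟨τ, hτ, ?_⟩
  set h : ι → ℝ → ℝ := fun j => subdiffResidual (y j) τ with hh
  have hmem : ∀ j, MemLp (h j) 2 (gaussianReal 0 1) := fun j => memLp_subdiffResidual (y j) hτ
  have hmean : ∑ j, ∫ u, h j u ∂(gaussianReal 0 1) = 0 := by
    have h1 : ∀ j, ∫ u, h j u ∂(gaussianReal 0 1) =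
        if y j ≠ 0 then -τ else ∫ u, excess τ u ∂(gaussianReal 0 1) := by
      intro j
      by_cases hj : y j = 0
      · simp [hh, hj, subdiffResidual_zero]
      · simp [hh, hj, integral_subdiffResidual_of_ne]
    rw [Finset.sum_congr rfl fun j _ => h1 j, sum_ite_ne_zero]
    linarith
  have hvar : ∑ j, Var[h j; gaussianReal 0 1] ≤ s + (q - s) * phi τ := by
    refine (Finset.sum_le_sum fun j _ => variance_subdiffResidual_le (y j) hτ).trans ?_
    rw [sum_ite_ne_zero, mul_one]
  have hsum : ∑ j, ∫ u, h j u ^ 2 ∂(gaussianReal 0 1) = s * (τ ^ 2 + 1) + (q - s) * phi τ := by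
    rw [Finset.sum_congr rfl fun j _ => integral_subdiffResidual_sq (y j) hτ, sum_ite_ne_zero]
  have hint := integrable_sum_coord fun j => (hmem j).integrable_sq
  have hint2 := (integrable_sq_sum_coord hmem).div_const s
  have hpoint : ∀ g : EuclideanSpace ℝ ι, ∑ j, h j (g j) ^ 2 - (∑ j, h j (g j)) ^ 2 / s ≤
      Metric.infDist g (polarCone (descentCone (weightedL1 fun _ : ι => (1 : ℝ)) y)) ^ 2 := by
    intro g
    refine le_infDist_sq ⟨0, zero_mem_polarCone _⟩ fun u hu => ?_
    obtain ⟨σ, hσ, hσ'⟩ := exists_of_mem_polarCone_descentCone hu hy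
    have h1 := Finset.sum_le_sum fun j (_ : j ∈ Finset.univ) =>
      sq_subdiffResidual_le τ (g j) (hσ j) (hσ' j)
    have h2 : ∑ j, (if y j ≠ 0 then (1 : ℝ) else 0) = s := by rw [sum_ite_ne_zero]; simp [hsdef]
    rw [Finset.sum_add_distrib, Finset.sum_sub_distrib, ← Finset.sum_mul, ← Finset.sum_mul,
      ← Finset.mul_sum, h2] at h1
    rw [dist_sq_euclidean]
    refine le_trans ?_ h1
    -- Complete the square in `σ - τ`.
    have h3 : ∀ X d : ℝ, -(X ^ 2 / s) ≤ -(2 * X * d) + s * d ^ 2 := by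
      intro X d
      have : s * (d - X / s) ^ 2 = s * d ^ 2 - 2 * X * d + X ^ 2 / s := by
        field_simp
        ring
      nlinarith [mul_nonneg hs.le (sq_nonneg (d - X / s))]
    have := h3 (∑ j, h j (g j)) (σ - τ)
    simp only [hh] at this ⊢
    linarith
  have hE := integral_mono (hint.sub hint2) (integrable_infDist_sq _) hpoint
  rw [integral_sub' hint hint2, integral_sum_coord fun j => (hmem j).integrable_sq,
    integral_div, integral_sq_sum_coord hmem hmean, hsum] at hE
  have h4 : (∑ j, Var[h j; gaussianReal 0 1]) / s ≤ (s + (q - s) * phi τ) / s := by gcongr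
  have h5 := stationary_error_le hs hsq hτ hstat
  unfold statDim
  linarith

end Block

/-! ### Block weights -/

section Blocks

variable {p L : ℕ} {P : Fin L → Finset (Fin p)}

lemma sum_eq_sum_blocks (hdisj : ∀ i j : Fin L, i ≠ j → Disjoint (P i) (P j))
    (hcover : ∀ k : Fin p, ∃ i : Fin L, k ∈ P i) (f : Fin p → ℝ) :
    ∑ k, f k = ∑ i, ∑ k ∈ P i, f k := by
  rw [← Finset.sum_biUnion fun i _ j _ hij => hdisj i j hij]
  refine Finset.sum_congr ?_ fun _ _ => rfl
  ext k
  simpa using hcover k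

lemma blockWeights_of_mem (hdisj : ∀ i j : Fin L, i ≠ j → Disjoint (P i) (P j)) (ω : Fin L → ℝ)
    {i : Fin L} {k : Fin p} (hk : k ∈ P i) : blockWeights P ω k = ω i := by
  rw [blockWeights, Finset.sum_eq_single i, if_pos hk]
  · intro j _ hj
    exact if_neg fun h => Finset.disjoint_left.1 (hdisj j i hj) h hk
  · simp

lemma blockWeights_nonneg {ω : Fin L → ℝ} (hω : ∀ i, 0 ≤ ω i) (k : Fin p) :
    0 ≤ blockWeights P ω k :=
  Finset.sum_nonneg fun i _ => by split_ifs <;> simp [hω i]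

/-- The coordinate restriction of a vector polar to the descent cone of the weighted norm is polar
to the descent cone of the `ℓ₁` norm of the block: the descent cone of a block, extended by zero,
is contained in the descent cone of the weighted norm. -/
lemma subvector_mem_polarCone (hdisj : ∀ i j : Fin L, i ≠ j → Disjoint (P i) (P j))
    {ω : Fin L → ℝ} (hω : ∀ i, 0 ≤ ω i) {y u : EuclideanSpace ℝ (Fin p)}
    (hu : u ∈ polarCone (descentCone (weightedL1 (blockWeights P ω)) y)) (i : Fin L) :
    subvector u (P i) ∈
      polarCone (descentCone (weightedL1 fun _ : P i => (1 : ℝ)) (subvector y (P i))) := by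
  rintro z ⟨t, ht, hz⟩
  set Z : EuclideanSpace ℝ (Fin p) :=
    WithLp.toLp 2 fun k => if hk : k ∈ P i then z ⟨k, hk⟩ else 0 with hZ
  have hZmem : ∀ k : P i, Z k = z k := fun k => by simp [hZ]
  have hZnot : ∀ k ∉ P i, Z k = 0 := fun k hk => by simp [hZ, hk]
  have hsum : ∀ F : Fin p → ℝ, (∀ k ∉ P i, F k = 0) → ∑ k, F k = ∑ k : P i, F k := by
    intro F hF
    rw [Finset.sum_coe_sort (P i) F]
    exact (Finset.sum_subset (Finset.subset_univ _) fun k _ hk => hF k hk).symm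
  have hmem : Z ∈ descentCone (weightedL1 (blockWeights P ω)) y := by
    refine ⟨t, ht, ?_⟩
    rw [← sub_nonpos, weightedL1, weightedL1, ← Finset.sum_sub_distrib,
      hsum _ fun k hk => by simp [hZnot k hk]]
    have h1 : ∀ k : P i, blockWeights P ω k * |(y + t • Z) k| - blockWeights P ω k * |y k| =
        ω i * (|(subvector y (P i) + t • z) k| - |subvector y (P i) k|) := by
      intro k
      rw [blockWeights_of_mem hdisj ω k.2]
      simp [subvector, hZmem k]
      ring
    rw [Finset.sum_congr rfl fun k _ => h1 k, ← Finset.mul_sum, Finset.sum_sub_distrib]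
    refine mul_nonpos_of_nonneg_of_nonpos (hω i) (sub_nonpos.2 ?_)
    simpa [weightedL1] using hz
  have h2 := hu Z hmem
  rw [inner_euclidean, hsum _ fun k hk => by simp [hZnot k hk]] at h2
  rw [inner_euclidean]
  refine (Finset.sum_congr rfl fun k _ => ?_).trans_le h2
  simp [subvector, hZmem k]

/-- The statistical dimension of the descent cone of a block weighted norm is at least the sum of
the statistical dimensions of the blocks. -/
lemma sum_statDim_le (hdisj : ∀ i j : Fin L, i ≠ j → Disjoint (P i) (P j))
    (hcover : ∀ k : Fin p, ∃ i : Fin L, k ∈ P i) {ω : Fin L → ℝ} (hω : ∀ i, 0 ≤ ω i)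
    (y : EuclideanSpace ℝ (Fin p)) :
    ∑ i, statDim (descentCone (weightedL1 fun _ : P i => (1 : ℝ)) (subvector y (P i))) ≤
      statDim (descentCone (weightedL1 (blockWeights P ω)) y) := by
  set C : ∀ i, Set (EuclideanSpace ℝ (P i)) := fun i =>
    descentCone (weightedL1 fun _ : P i => (1 : ℝ)) (subvector y (P i)) with hC
  have hint : ∀ i, Integrable (fun g : EuclideanSpace ℝ (Fin p) =>
      Metric.infDist (subvector g (P i)) (polarCone (C i)) ^ 2) (stdGaussian _) := fun i =>
    (measurePreserving_subvector (P i)).integrable_comp_of_integrable (integrable_infDist_sq (C i))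
  have heq : ∀ i, statDim (C i) = ∫ g : EuclideanSpace ℝ (Fin p),
      Metric.infDist (subvector g (P i)) (polarCone (C i)) ^ 2 ∂(stdGaussian _) := by
    intro i
    rw [statDim, ← (measurePreserving_subvector (P i)).map_eq,
      integral_map (measurePreserving_subvector (P i)).measurable.aemeasurable]
    exact ((Metric.continuous_infDist_pt _).pow 2).aestronglyMeasurable
  rw [Finset.sum_congr rfl fun i _ => heq i, ← integral_finsetSum _ fun i _ => hint i]
  refine integral_mono (integrable_finsetSum _ fun i _ => hint i) (integrable_infDist_sq _)
    fun g => le_infDist_sq ⟨0, zero_mem_polarCone _⟩ fun u hu => ?_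
  rw [dist_sq_euclidean, sum_eq_sum_blocks hdisj hcover]
  refine Finset.sum_le_sum fun i _ => ?_
  refine (pow_le_pow_left₀ Metric.infDist_nonneg (Metric.infDist_le_dist_of_mem
    (subvector_mem_polarCone hdisj hω hu i)) 2).trans_eq ?_
  rw [dist_sq_euclidean, ← Finset.sum_coe_sort (P i)]
  rfl

/-! ### The block contributions to `Psi` -/

lemma card_subvector_support (y : EuclideanSpace ℝ (Fin p)) (T : Finset (Fin p)) :
    (Finset.univ.filter fun j => subvector y T j ≠ 0).card = (T ∩ vecSupport y).card := by
  rw [← Finset.card_map (Function.Embedding.subtype _)]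
  congr 1
  ext k
  simp only [Finset.mem_map, Finset.mem_inter, vecSupport]
  constructor
  · rintro ⟨j, hj, rfl⟩
    exact ⟨j.2, Finset.mem_filter.2 ⟨Finset.mem_univ _, (Finset.mem_filter.1 hj).2⟩⟩
  · rintro ⟨hk, hy⟩
    exact ⟨⟨k, hk⟩, Finset.mem_filter.2 ⟨Finset.mem_univ _, (Finset.mem_filter.1 hy).2⟩, rfl⟩

lemma sum_block_ite (y : EuclideanSpace ℝ (Fin p)) (T : Finset (Fin p)) (a b : ℝ) :
    ∑ k ∈ T, (if y k ≠ 0 then a else b) =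
      (T ∩ vecSupport y).card * a + ((T.card : ℝ) - (T ∩ vecSupport y).card) * b := by
  have h := sum_ite_ne_zero (subvector y T) a b
  rw [card_subvector_support, Fintype.card_coe] at h
  rw [← h, ← Finset.sum_coe_sort T]
  rfl

/-- The contribution `ρ_i (α_i (τ² + 1) + (1 - α_i) φ(τ))` of the block `i` to `Psi`, as a
function of the product `τ = t ω_i`. -/
noncomputable def blockPsi (P : Fin L → Finset (Fin p)) (y : EuclideanSpace ℝ (Fin p)) (i : Fin L)
    (τ : ℝ) : ℝ :=
  relSize P i * (accuracy P y i * (τ ^ 2 + 1) + (1 - accuracy P y i) * phi τ)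

lemma Psi_eq_sum_blockPsi (y : EuclideanSpace ℝ (Fin p)) (ω : Fin L → ℝ) (t : ℝ) :
    Psi P y ω t = ∑ i, blockPsi P y i (t * ω i) := by
  simp only [Psi, blockPsi, mul_pow]

lemma blockPsi_eq {y : EuclideanSpace ℝ (Fin p)} {i : Fin L}
    (hmeet : (P i ∩ vecSupport y).Nonempty) (τ : ℝ) :
    blockPsi P y i τ = ((P i ∩ vecSupport y).card * (τ ^ 2 + 1) +
      (((P i).card : ℝ) - (P i ∩ vecSupport y).card) * phi τ) / p := by
  have h : ((P i).card : ℝ) ≠ 0 := by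
    exact_mod_cast (Finset.card_pos.2 (hmeet.mono Finset.inter_subset_left)).ne'
  rw [blockPsi, relSize, accuracy]
  field_simp

lemma blockPsi_nonneg (y : EuclideanSpace ℝ (Fin p)) (i : Fin L) {τ : ℝ} (hτ : 0 ≤ τ) :
    0 ≤ blockPsi P y i τ := by
  have h1 : accuracy P y i ≤ 1 := div_le_one_of_le₀
    (by exact_mod_cast Finset.card_le_card Finset.inter_subset_left) (by positivity)
  have h2 : 0 ≤ accuracy P y i := by unfold accuracy; positivity
  have h3 : 0 ≤ relSize P i := by unfold relSize; positivity
  exact mul_nonneg h3 (add_nonneg (mul_nonneg h2 (by positivity))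
    (mul_nonneg (sub_nonneg.2 h1) (phi_nonneg hτ)))

/-- Each block contribution attains its minimum over `[0, ∞)`, being continuous and coercive. -/
lemma exists_isMinOn_blockPsi {y : EuclideanSpace ℝ (Fin p)} {i : Fin L}
    (hmeet : (P i ∩ vecSupport y).Nonempty) :
    ∃ τ, 0 ≤ τ ∧ ∀ τ', 0 ≤ τ' → blockPsi P y i τ ≤ blockPsi P y i τ' := by
  set s : ℝ := ((P i ∩ vecSupport y).card : ℝ) with hs
  set q : ℝ := ((P i).card : ℝ) with hq
  have hs1 : 1 ≤ s := by rw [hs]; exact_mod_cast Finset.card_pos.2 hmeet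
  have hsq : s ≤ q := by
    rw [hs, hq]
    exact_mod_cast Finset.card_le_card Finset.inter_subset_left
  set J : ℝ → ℝ := fun τ => s * (τ ^ 2 + 1) + (q - s) * phi τ with hJ
  have hcont : ContinuousOn J (Set.Ici 0) :=
    (by fun_prop : Continuous fun τ : ℝ => s * (τ ^ 2 + 1)).continuousOn.add
      (continuousOn_const.mul continuousOn_phi)
  -- Beyond `q` the quadratic term alone exceeds the value at `0`.
  have hq0 : 0 ≤ q := by linarith
  obtain ⟨τ, hτ, hmin⟩ := isCompact_Icc.exists_isMinOn ⟨0, Set.left_mem_Icc.2 hq0⟩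
    (hcont.mono fun x (hx : x ∈ Set.Icc 0 q) => hx.1)
  refine ⟨τ, hτ.1, fun τ' hτ' => ?_⟩
  rw [blockPsi_eq hmeet, blockPsi_eq hmeet]
  refine div_le_div_of_nonneg_right (show J τ ≤ J τ' from ?_) (Nat.cast_nonneg p)
  rcases le_or_gt τ' q with h | h
  · exact hmin ⟨hτ', h⟩
  · refine (hmin (Set.left_mem_Icc.2 hq0)).trans ?_
    have h1 := mul_le_mul_of_nonneg_left (phi_le_one le_rfl) (sub_nonneg.2 hsq)
    have h2 := mul_nonneg (sub_nonneg.2 hsq) (phi_nonneg hτ')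
    have h3 : q ≤ τ' ^ 2 := by nlinarith
    have h4 : τ' ^ 2 ≤ s * τ' ^ 2 := le_mul_of_one_le_left (sq_nonneg _) hs1
    simp only [hJ]
    linarith

/-! ### Optimal weights -/

lemma bddBelow_Psi (y : EuclideanSpace ℝ (Fin p)) {ω : Fin L → ℝ} (hω : ∀ i, 0 ≤ ω i) :
    BddBelow (Psi P y ω '' Set.Ici 0) := by
  refine ⟨0, ?_⟩
  rintro _ ⟨t, ht, rfl⟩
  rw [Psi_eq_sum_blockPsi]
  exact Finset.sum_nonneg fun i _ => blockPsi_nonneg y i (mul_nonneg ht (hω i))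

lemma sInf_Psi_le_sum_blockPsi (y : EuclideanSpace ℝ (Fin p)) {ω : Fin L → ℝ} (hω : ∀ i, 0 ≤ ω i) :
    sInf (Psi P y ω '' Set.Ici 0) ≤ ∑ i, blockPsi P y i (ω i) := by
  refine csInf_le (bddBelow_Psi y hω) ⟨1, Set.mem_Ici.2 zero_le_one, ?_⟩
  simp [Psi_eq_sum_blockPsi]

/-- Optimal weights exist: collect the minimizers of the block contributions, which are attained
simultaneously at `t = 1`. -/
lemma exists_isOptimalWeights {n : ℕ} (Ω : Matrix (Fin p) (Fin n) ℝ) (x : EuclideanSpace ℝ (Fin n))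
    (hmeet : ∀ i : Fin L, (P i ∩ vecSupport (Matrix.toEuclideanLin Ω x)).Nonempty) :
    ∃ ω : Fin L → ℝ, IsOptimalWeights Ω x P ω := by
  choose τ hτ hmin using fun i => exists_isMinOn_blockPsi (hmeet i)
  refine ⟨τ, hτ, fun ω' hω' => ?_⟩
  refine add_le_add_left (mul_le_mul_of_nonneg_left ?_ (sq_nonneg _)) _
  refine (sInf_Psi_le_sum_blockPsi _ hτ).trans (le_csInf (Set.nonempty_Ici.image _) ?_)
  rintro _ ⟨t, ht, rfl⟩
  rw [Psi_eq_sum_blockPsi]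
  exact Finset.sum_le_sum fun i _ => hmin i _ (mul_nonneg ht (hω' i))

lemma condNumber_pos {n : ℕ} {Ω : Matrix (Fin p) (Fin n) ℝ} (hΩ : 0 < sigmaMin Ω) :
    0 < condNumber Ω :=
  div_pos (hΩ.trans_le (LinearMap.singularValues_antitone _ (Nat.zero_le _))) hΩ

/-- For optimal weights, the infimum in `measUpper` is bounded by every sum of block
contributions, with the arguments of the blocks chosen independently. -/
lemma IsOptimalWeights.sInf_Psi_le {n : ℕ} {Ω : Matrix (Fin p) (Fin n) ℝ} (hΩ : 0 < sigmaMin Ω)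
    {x : EuclideanSpace ℝ (Fin n)} {ω : Fin L → ℝ} (hω : IsOptimalWeights Ω x P ω)
    {τ : Fin L → ℝ} (hτ : ∀ i, 0 ≤ τ i) :
    sInf (Psi P (Matrix.toEuclideanLin Ω x) ω '' Set.Ici 0) ≤
      ∑ i, blockPsi P (Matrix.toEuclideanLin Ω x) i (τ i) := by
  have h := hω.2 τ hτ
  simp only [measUpper, add_le_add_iff_right] at h
  exact (le_of_mul_le_mul_left h (pow_pos (condNumber_pos hΩ) 2)).trans
    (sInf_Psi_le_sum_blockPsi _ hτ)

/-- `Psi` is the normalized expected squared distance to a multiple of the subdifferential, hence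
an upper bound for the normalized statistical dimension. -/
lemma statDim_div_le_Psi (hdisj : ∀ i j : Fin L, i ≠ j → Disjoint (P i) (P j))
    (hcover : ∀ k : Fin p, ∃ i : Fin L, k ∈ P i) {y : EuclideanSpace ℝ (Fin p)}
    (hmeet : ∀ i : Fin L, (P i ∩ vecSupport y).Nonempty) {ω : Fin L → ℝ} (hω : ∀ i, 0 ≤ ω i)
    {t : ℝ} (ht : 0 ≤ t) :
    statDim (descentCone (weightedL1 (blockWeights P ω)) y) / p ≤ Psi P y ω t := by
  rw [Psi_eq_sum_blockPsi, Finset.sum_congr rfl fun i _ => blockPsi_eq (hmeet i) (t * ω i),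
    ← Finset.sum_div]
  refine div_le_div_of_nonneg_right ?_ (Nat.cast_nonneg p)
  refine (statDim_descentCone_le (blockWeights_nonneg hω) y ht).trans_eq ?_
  rw [sum_eq_sum_blocks hdisj hcover]
  refine Finset.sum_congr rfl fun i _ => ?_
  rw [← sum_block_ite]
  exact Finset.sum_congr rfl fun k hk => by rw [blockWeights_of_mem hdisj ω hk]

/-- With optimal weights, the statistical dimension exceeds the sum over the blocks by at most
the sum of the errors of the subdifferential bounds of the blocks. -/
lemma IsOptimalWeights.statDim_le {n : ℕ} {Ω : Matrix (Fin p) (Fin n) ℝ} (hΩ : 0 < sigmaMin Ω)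
    {x : EuclideanSpace ℝ (Fin n)} {ω : Fin L → ℝ}
    (hdisj : ∀ i j : Fin L, i ≠ j → Disjoint (P i) (P j))
    (hcover : ∀ k : Fin p, ∃ i : Fin L, k ∈ P i)
    (hmeet : ∀ i : Fin L, (P i ∩ vecSupport (Matrix.toEuclideanLin Ω x)).Nonempty)
    (hω : IsOptimalWeights Ω x P ω) :
    statDim (descentCone (weightedL1 (blockWeights P ω)) (Matrix.toEuclideanLin Ω x)) / p ≤
      (∑ i, (statDim (descentCone (weightedL1 fun _ : P i => (1 : ℝ))
          (subvector (Matrix.toEuclideanLin Ω x) (P i))) +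
        2 * √((P i).card / (P i ∩ vecSupport (Matrix.toEuclideanLin Ω x)).card))) / p := by
  set y := Matrix.toEuclideanLin Ω x
  have hblock : ∀ i, ∃ k, subvector y (P i) k ≠ 0 := by
    intro i
    have h := Finset.card_pos.2 (hmeet i)
    rw [← card_subvector_support] at h
    obtain ⟨k, hk⟩ := Finset.card_pos.1 h
    exact ⟨k, by simpa using hk⟩
  choose τ hτ hle using fun i => exists_le_statDim_add (subvector y (P i)) (hblock i)
  calc statDim (descentCone (weightedL1 (blockWeights P ω)) y) / p
      ≤ sInf (Psi P y ω '' Set.Ici 0) := by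
        refine le_csInf (Set.nonempty_Ici.image _) ?_
        rintro _ ⟨t, ht, rfl⟩
        exact statDim_div_le_Psi hdisj hcover hmeet hω.1 ht
    _ ≤ ∑ i, blockPsi P y i (τ i) := hω.sInf_Psi_le hΩ hτ
    _ ≤ _ := by
        rw [Finset.sum_congr rfl fun i _ => blockPsi_eq (hmeet i) (τ i), ← Finset.sum_div]
        refine div_le_div_of_nonneg_right (Finset.sum_le_sum fun i _ => ?_) (Nat.cast_nonneg p)
        have h := hle i
        rwa [card_subvector_support, Fintype.card_coe] at h

end Blocks

/-! ### Comparison of the numbers of measurements -/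

theorem mainTheorem1 {p n L : ℕ} (Ω : Matrix (Fin p) (Fin n) ℝ) (hΩ : 0 < sigmaMin Ω)
    (x : EuclideanSpace ℝ (Fin n)) (P : Fin L → Finset (Fin p))
    (hdisj : ∀ i j : Fin L, i ≠ j → Disjoint (P i) (P j))
    (hcover : ∀ k : Fin p, ∃ i : Fin L, k ∈ P i)
    (hmeet : ∀ i : Fin L, (P i ∩ vecSupport (Matrix.toEuclideanLin Ω x)).Nonempty) :
    (∃ ω : Fin L → ℝ, IsOptimalWeights Ω x P ω) ∧
    ∀ ω : Fin L → ℝ, IsOptimalWeights Ω x P ω →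
      (1 - (L : ℝ)) / p - 2 * condNumber Ω ^ 2 / √((p : ℝ) * L) ≤
          measWeighted Ω x (blockWeights P ω) - ∑ i : Fin L, measPiece Ω x (P i) ∧
        measWeighted Ω x (blockWeights P ω) - ∑ i : Fin L, measPiece Ω x (P i) ≤
          2 * condNumber Ω ^ 2 / √(p : ℝ) *
              ∑ i : Fin L,
                1 / √((P i ∩ vecSupport (Matrix.toEuclideanLin Ω x)).card : ℝ) +
            (1 - (L : ℝ)) / p := by
  refine ⟨exists_isOptimalWeights Ω x hmeet, fun ω hω => ?_⟩
  set y := Matrix.toEuclideanLin Ω x with hy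
  set δ : ℝ := statDim (descentCone (weightedL1 (blockWeights P ω)) y) with hδ
  set d : Fin L → ℝ := fun i =>
    statDim (descentCone (weightedL1 fun _ : P i => (1 : ℝ)) (subvector y (P i))) with hd
  have hκ : 0 ≤ condNumber Ω ^ 2 := sq_nonneg _
  have hdiff : measWeighted Ω x (blockWeights P ω) - ∑ i : Fin L, measPiece Ω x (P i) =
      condNumber Ω ^ 2 * ((δ - ∑ i, d i) / p) + (1 - (L : ℝ)) / p := by
    simp only [measWeighted, measPiece, Finset.sum_add_distrib, ← Finset.mul_sum,
      ← Finset.sum_div, Finset.sum_const, Finset.card_univ, Fintype.card_fin, nsmul_eq_mul]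
    simp only [hδ, hd, hy]
    ring
  rw [hdiff]
  constructor
  · have h1 : 0 ≤ (δ - ∑ i, d i) / p :=
      div_nonneg (sub_nonneg.2 (sum_statDim_le hdisj hcover hω.1 y)) (Nat.cast_nonneg p)
    have h2 := mul_nonneg hκ h1
    have h3 : 0 ≤ 2 * condNumber Ω ^ 2 / √((p : ℝ) * L) := by positivity
    linarith
  · have h1 := hω.statDim_le hΩ hdisj hcover hmeet
    have h2 : (δ - ∑ i, d i) / p ≤
        2 / √(p : ℝ) * ∑ i : Fin L, 1 / √((P i ∩ vecSupport y).card : ℝ) := by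
      rw [Finset.sum_add_distrib, add_div] at h1
      rw [sub_div]
      refine (sub_le_iff_le_add'.2 h1).trans ?_
      rw [Finset.sum_div, Finset.mul_sum]
      refine Finset.sum_le_sum fun i _ => ?_
      have h3 : √((P i).card : ℝ) ≤ √(p : ℝ) := by
        refine Real.sqrt_le_sqrt ?_
        exact_mod_cast (Finset.card_le_univ (P i)).trans_eq (Fintype.card_fin p)
      rw [Real.sqrt_div (Nat.cast_nonneg _)]
      calc 2 * (√((P i).card : ℝ) / √((P i ∩ vecSupport y).card : ℝ)) / p
          ≤ 2 * (√(p : ℝ) / √((P i ∩ vecSupport y).card : ℝ)) / p := by gcongr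
        _ = 2 * (√(p : ℝ) / p) * (1 / √((P i ∩ vecSupport y).card : ℝ)) := by ring
        _ = 2 / √(p : ℝ) * (1 / √((P i ∩ vecSupport y).card : ℝ)) := by
            rw [Real.sqrt_div_self']
            ring
    have h3 := mul_le_mul_of_nonneg_left h2 hκ
    refine add_le_add_left (h3.trans_eq ?_) _
    ring
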